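/- Let $A\in\mathbb R^{n\times d}$ be a random matrix whose entries $a_{ij}$ are i.i.d., centered and $\sigma$-sub-Gaussian ($\sigma>0$), i.e. $\mathbb E\exp(a_{ij}z)\le \exp(\sigma^2z^2/2)$ for all $z\in\mathbb R$, or $\mathbb P(|a_{ij}|>z)\le 2\exp(-z^2/(2\sigma^2))$ for all $z\ge 0$, and assume that $\sigma^2$ is comparable to the variance of the entries: $\sigma^2\le B\,\mathrm{Var}(a_{ij})$ for some $B\ge 1$. Let $y=Ax^*+\varepsilon$ with arbitrary $x^*\in\mathbb R^d$ and arbitrary noise $\varepsilon$, let $\gamma\ge 0$, and let $$F(x)=\frac1{2n}\sum_{i=1}^n (y_i-a_i\cdot x)^2+\frac{\gamma}{2}\|x\|_2^2,\qquad x\in\mathbb R^d,$$ be the sparse linear regression objective, where $a_i$ is the $i$-th row of $A$. Let $k,K\ge 0$ be integers (the sparsity parameters) with $k+K\ge 1$ and $3k+K\le d$. For $r\ge 1$ let $L_r$ be the smallest $L$ with $F(x')-F(x)-\langle\nabla F(x),x'-x\rangle\le \frac L2\|x'-x\|_2^2$ for all $x,x'$ with $\|x-x'\|_0\le r$ (restricted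 smoothness), and let $\alpha_r$ be the largest $\alpha>0$, if one exists, with $F(x')-F(x)-\langle\nabla F(x),x'-x\rangle\ge \frac{\alpha}2\|x'-x\|_2^2$ for all such $x,x'$ (restricted strong convexity). The restricted condition number is $c'=L_{2k+K}/\alpha_{k+K}$. Then for every $B\ge 1$ there is a constant $C_1>0$ depending only on $B$ (hence an absolute constant when $\mathrm{Var}(a_{ij})=\sigma^2$) such that, whenever $$n\ \ge\ 8C_1(3k+K)\log\frac{\mathrm e\,d}{3k+K},$$ with probability at least $1-2\exp(-n/(8C_1))$ the parameter $\alpha_{k+K}>0$ exists and $c'\le 3$. -/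

import Mathlib

open MeasureTheory ProbabilityTheory

namespace SparseRegression

/-- Restricted strong convexity of `f` with parameter `α > 0` at sparsity level `r`. -/
def RestrictedStronglyConvex {d : ℕ} (f : EuclideanSpace ℝ (Fin d) → ℝ) (r : ℕ) (α : ℝ) : Prop :=
  Differentiable ℝ f ∧ 0 < α ∧
    ∀ x x' : EuclideanSpace ℝ (Fin d), hammingNorm (x - x').ofLp ≤ r →
      α / 2 * ‖x' - x‖ ^ 2 ≤ f x' - f x - inner ℝ (gradient f x) (x' - x)

/-- Restricted smoothness of `f` with parameter `L` at sparsity level `r`: the quadratic upper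
bound on `f` along `r`-sparse directions. -/
def RestrictedSmooth {d : ℕ} (f : EuclideanSpace ℝ (Fin d) → ℝ) (r : ℕ) (L : ℝ) : Prop :=
  Differentiable ℝ f ∧
    ∀ x x' : EuclideanSpace ℝ (Fin d), hammingNorm (x - x').ofLp ≤ r →
      f x' - f x - inner ℝ (gradient f x) (x' - x) ≤ L / 2 * ‖x' - x‖ ^ 2

/-- `c = L / α`, where `L` is the smallest restricted smoothness parameter of `f` at level `p` and
`α > 0` is the largest restricted strong convexity parameter of `f` at level `q`. Both optimal
parameters are required to exist, so that no `c` is a restricted condition number of `f` if `f` is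
not restricted strongly convex. -/
def IsRestrictedConditionNumber {d : ℕ} (f : EuclideanSpace ℝ (Fin d) → ℝ) (p q : ℕ) (c : ℝ) :
    Prop :=
  ∃ L α : ℝ, IsLeast {L' : ℝ | RestrictedSmooth f p L'} L ∧
    IsGreatest {α' : ℝ | RestrictedStronglyConvex f q α'} α ∧ c = L / α

/-- The (ridge-regularized) least-squares objective of sparse linear regression,
`F(x) = (1 / (2n)) ∑ i, (y i - a i ⬝ x) ^ 2 + (γ / 2) ‖x‖ ^ 2`, with `a i` the rows of `A`. -/
noncomputable def leastSquares {n d : ℕ} (A : Matrix (Fin n) (Fin d) ℝ) (y : Fin n → ℝ) (γ : ℝ)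
    (x : EuclideanSpace ℝ (Fin d)) : ℝ :=
  1 / (2 * (n : ℝ)) * ∑ i, (y i - ∑ j, A i j * x j) ^ 2 + γ / 2 * ‖x‖ ^ 2

/-- A centered real random variable is `σ`-sub-Gaussian if `𝔼 exp (θ z) ≤ exp (σ² z² / 2)` for all
real `z`, or `ℙ (|θ| > z) ≤ 2 exp (-z² / (2 σ²))` for all `z ≥ 0`. The two conditions are usually
called equivalent, which is true up to an absolute factor in `σ`; either one is accepted. -/
def IsSubGaussian {Ω : Type*} [MeasurableSpace Ω] (θ : Ω → ℝ) (σ : ℝ) (μ : Measure Ω) : Prop :=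
  Integrable θ μ ∧ ∫ ω, θ ω ∂μ = 0 ∧
    ((∀ z : ℝ, Integrable (fun ω => Real.exp (θ ω * z)) μ ∧
        ∫ ω, Real.exp (θ ω * z) ∂μ ≤ Real.exp (σ ^ 2 * z ^ 2 / 2)) ∨
      ∀ z : ℝ, 0 ≤ z →
        μ.real {ω | z < |θ ω|} ≤ 2 * Real.exp (-z ^ 2 / (2 * σ ^ 2)))

/-- A random matrix whose entries are i.i.d. centered `σ`-sub-Gaussian random variables. -/
structure IsSubGaussianDesign {Ω : Type*} [MeasurableSpace Ω] {n d : ℕ}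
    (A : Ω → Matrix (Fin n) (Fin d) ℝ) (σ : ℝ) (μ : Measure Ω) : Prop where
  measurable : ∀ i j, Measurable fun ω => A ω i j
  indep : iIndepFun (fun (p : Fin n × Fin d) (ω : Ω) => A ω p.1 p.2) μ
  identDistrib : ∀ p q : Fin n × Fin d,
    IdentDistrib (fun ω => A ω p.1 p.2) (fun ω => A ω q.1 q.2) μ μ
  subGaussian : ∀ i j, IsSubGaussian (fun ω => A ω i j) σ μ

end SparseRegression

namespace SparseRegression

/-! The Taylor remainder of `F` in direction `h` is `‖A h‖² / (2n) + γ/2 * ‖h‖²`, free of the base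
point and of `y`, so the noise is irrelevant. If `v` is the entry variance and `|‖A h‖² - n v ‖h‖²|
≤ (n v / 2) ‖h‖²` for all `(3k+K)`-sparse `h` (restricted isometry), then `α ≥ v/2 + γ` and `L ≤
3v/2 + γ ≤ 3α`.

Restricted isometry holds with high probability by concentration and a union bound. For fixed `h`
the row products are independent and sub-Gaussian, so their centered squares are sub-exponential and
Chernoff gives deviation `n v / 8` (`measureReal_gramDeviation_gt_le`). On each coordinate subspace
a bilinear form is at most 4 times its maximum on a `1/2`-net, and polarization replaces pairs of
net points by their sums and differences (`exists_test_vectors`). This leaves at most `d.choose s *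
50 ^ s` vectors with `s = 3k+K`, a number which the lower bound on `n` absorbs. -/

/-! ### Taylor remainders and restricted condition numbers -/

lemma differentiable_leastSquares {n d : ℕ} (A : Matrix (Fin n) (Fin d) ℝ) (y : Fin n → ℝ)
    (γ : ℝ) : Differentiable ℝ (leastSquares A y γ) := by
  unfold leastSquares
  simp only [EuclideanSpace.real_norm_sq_eq]
  fun_prop

/-- The first-order Taylor remainder of a function that is quadratic along a line. -/
lemma taylor_remainder_of_quadratic {E : Type*} [NormedAddCommGroup E] [InnerProductSpace ℝ E]
    [CompleteSpace E] {f : E → ℝ} {x h : E} (hf : DifferentiableAt ℝ f x) {l q : ℝ}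
    (hq : ∀ t : ℝ, f (x + t • h) = f x + t * l + t ^ 2 * q) :
    f (x + h) - f x - inner ℝ (gradient f x) h = q := by
  have h1 : inner ℝ (gradient f x) h = l := by
    rw [gradient, InnerProductSpace.toDual_symm_apply, ← hf.lineDeriv_eq_fderiv, lineDeriv]
    simp only [hq]
    have : HasDerivAt (fun t : ℝ => f x + t * l + t ^ 2 * q) (0 + 1 * l + ((2 : ℕ) * 0 ^ (2 - 1)) * q) 0 := by
      refine ((hasDerivAt_const _ _).add ((hasDerivAt_id' 0).mul_const l)).add
        ((hasDerivAt_pow 2 0).mul_const q)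
    simpa using this.deriv
  have h2 := hq 1
  simp only [one_smul] at h2
  rw [h1, h2]
  ring

lemma leastSquares_taylor_remainder {n d : ℕ} (A : Matrix (Fin n) (Fin d) ℝ) (y : Fin n → ℝ)
    (γ : ℝ) (x x' : EuclideanSpace ℝ (Fin d)) :
    leastSquares A y γ x' - leastSquares A y γ x
        - inner ℝ (gradient (leastSquares A y γ) x) (x' - x) =
      1 / (2 * (n : ℝ)) * ∑ i, (∑ j, A i j * (x' - x) j) ^ 2 + γ / 2 * ‖x' - x‖ ^ 2 := by
  obtain ⟨h, rfl⟩ : ∃ h, x' = x + h := ⟨x' - x, by abel⟩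
  rw [add_sub_cancel_left]
  refine taylor_remainder_of_quadratic (differentiable_leastSquares A y γ x)
    (l := 1 / (2 * (n : ℝ)) * ∑ i, (-2 * (y i - ∑ j, A i j * x j) * ∑ j, A i j * h j)
      + γ / 2 * (2 * inner ℝ x h)) fun t => ?_
  have h1 : ∀ i, ∑ j, A i j * (x + t • h) j = ∑ j, A i j * x j + t * ∑ j, A i j * h j := by
    intro i
    rw [Finset.mul_sum, ← Finset.sum_add_distrib]
    refine Finset.sum_congr rfl fun j _ => ?_
    simp only [PiLp.add_apply, PiLp.smul_apply, smul_eq_mul]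
    ring
  have h2 : ∑ i, (y i - ∑ j, A i j * (x + t • h) j) ^ 2 = ∑ i, (y i - ∑ j, A i j * x j) ^ 2
      + t * ∑ i, (-2 * (y i - ∑ j, A i j * x j) * ∑ j, A i j * h j)
      + t ^ 2 * ∑ i, (∑ j, A i j * h j) ^ 2 := by
    simp only [h1]
    rw [Finset.mul_sum, Finset.mul_sum, ← Finset.sum_add_distrib, ← Finset.sum_add_distrib]
    refine Finset.sum_congr rfl fun i _ => ?_
    ring
  have h3 : ‖x + t • h‖ ^ 2 = ‖x‖ ^ 2 + t * (2 * inner ℝ x h) + t ^ 2 * ‖h‖ ^ 2 := by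
    rw [norm_add_sq_real, inner_smul_right, norm_smul, mul_pow, Real.norm_eq_abs, sq_abs]
    ring
  simp only [leastSquares, h2, h3]
  ring

/-- One sparse unit direction bounds the smoothness parameters below and the convexity parameters
above, so the optimal ones are finite. -/
lemma exists_norm_eq_one_hammingNorm_le {d r : ℕ} (hd : 0 < d) (hr : 0 < r) :
    ∃ e : EuclideanSpace ℝ (Fin d), ‖e‖ = 1 ∧ hammingNorm (0 - e).ofLp ≤ r := by
  refine ⟨EuclideanSpace.single ⟨0, hd⟩ 1, by simp, le_trans ?_ hr⟩
  refine (Finset.card_le_card (t := {⟨0, hd⟩}) fun j hj => ?_).trans (by simp)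
  simpa using hj

/-- Two-sided quadratic bounds with constants `a`, `b` on the Taylor remainder along sparse
directions bound the restricted condition number by `b / a`. -/
lemma exists_isRestrictedConditionNumber_le {d p q : ℕ} (hd : 0 < d) (hp : 0 < p) (hq : 0 < q)
    {f : EuclideanSpace ℝ (Fin d) → ℝ} {a b M : ℝ}
    (hsc : RestrictedStronglyConvex f q a) (hsm : RestrictedSmooth f p b) (hb : b ≤ M * a)
    (hM : 0 ≤ M) :
    ∃ c, IsRestrictedConditionNumber f p q c ∧ c ≤ M := by
  obtain ⟨hf, ha, hsc⟩ := hsc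
  set S : Set ℝ := {L' : ℝ | RestrictedSmooth f p L'} with hS
  -- Positivity is left out of `T` to make it closed; `0 < a ≤ sSup T` restores it.
  set T : Set ℝ := {α : ℝ | ∀ x x' : EuclideanSpace ℝ (Fin d), hammingNorm (x - x').ofLp ≤ q →
      α / 2 * ‖x' - x‖ ^ 2 ≤ f x' - f x - inner ℝ (gradient f x) (x' - x)} with hT
  have hSc : IsClosed S := by
    simp only [hS, RestrictedSmooth, hf, true_and, Set.ofPred_forall]
    refine isClosed_iInter fun x => isClosed_iInter fun x' => isClosed_iInter fun _ => ?_
    exact isClosed_le (by fun_prop) (by fun_prop)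
  have hTc : IsClosed T := by
    simp only [hT, Set.ofPred_forall]
    refine isClosed_iInter fun x => isClosed_iInter fun x' => isClosed_iInter fun _ => ?_
    exact isClosed_le (by fun_prop) (by fun_prop)
  have hSb : BddBelow S := by
    obtain ⟨e, he, hh⟩ := exists_norm_eq_one_hammingNorm_le hd hp
    refine ⟨2 * (f e - f 0 - inner ℝ (gradient f 0) (e - 0)), fun L hL => ?_⟩
    have := hL.2 0 e hh
    rw [sub_zero, he] at this
    rw [sub_zero]
    linarith
  have hTb : BddAbove T := by
    obtain ⟨e, he, hh⟩ := exists_norm_eq_one_hammingNorm_le hd hq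
    refine ⟨2 * (f e - f 0 - inner ℝ (gradient f 0) (e - 0)), fun α hα => ?_⟩
    have := hα 0 e hh
    rw [sub_zero, he] at this
    rw [sub_zero]
    linarith
  have haT : a ≤ sSup T := le_csSup hTb hsc
  have hTm : sSup T ∈ T := hTc.csSup_mem ⟨a, hsc⟩ hTb
  refine ⟨sInf S / sSup T, ⟨sInf S, sSup T, ⟨hSc.csInf_mem ⟨b, hsm⟩ hSb, fun L hL =>
    csInf_le hSb hL⟩, ⟨⟨hf, ha.trans_le haT, hTm⟩, fun α hα => le_csSup hTb hα.2.2⟩, rfl⟩, ?_⟩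
  rw [div_le_iff₀ (ha.trans_le haT)]
  calc sInf S ≤ b := csInf_le hSb hsm
    _ ≤ M * a := hb
    _ ≤ M * sSup T := by gcongr

/-! ### Nets and bilinear forms -/

/-- The unit ball of a finite-dimensional real normed space has a `1/2`-net of cardinality at most
`5 ^ dim`. -/
lemma exists_half_net (E : Type*) [NormedAddCommGroup E] [NormedSpace ℝ E]
    [FiniteDimensional ℝ E] :
    ∃ N : Finset E, N.card ≤ 5 ^ Module.finrank ℝ E ∧ (∀ p ∈ N, ‖p‖ ≤ 1) ∧
      ∀ x : E, ‖x‖ ≤ 1 → ∃ p ∈ N, ‖x - p‖ ≤ 1 / 2 := by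
  classical
  -- A `1/2`-separated subset of the ball of maximal cardinality is a net. Scaling by 2 gives a
  -- 1-separated set in the ball of radius 2, where the bound `5 ^ dim` applies.
  let P : Finset E → Prop := fun N =>
    (∀ p ∈ N, ‖p‖ ≤ 1) ∧ ∀ p ∈ N, ∀ q ∈ N, p ≠ q → 1 / 2 ≤ ‖p - q‖
  have hcard : ∀ N, P N → N.card ≤ 5 ^ Module.finrank ℝ E := by
    intro N hN
    have hinj : Function.Injective fun x : E => (2 : ℝ) • x := smul_right_injective E two_ne_zero
    rw [← Finset.card_image_of_injective N hinj]
    refine Besicovitch.card_le_of_separated _ ?_ ?_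
    · simp only [Finset.forall_mem_image]
      intro p hp
      rw [norm_smul, Real.norm_ofNat]
      linarith [hN.1 p hp]
    · simp only [Finset.forall_mem_image]
      intro p hp q hq hpq
      rw [← smul_sub, norm_smul, Real.norm_ofNat]
      linarith [hN.2 p hp q hq fun h => hpq (by rw [h])]
  let K : Set ℕ := {m | ∃ N, P N ∧ N.card = m}
  have hKb : BddAbove K := ⟨5 ^ Module.finrank ℝ E, by rintro _ ⟨N, hN, rfl⟩; exact hcard N hN⟩
  have hKn : K.Nonempty := ⟨0, ∅, by simp [P], rfl⟩
  obtain ⟨N, hN, hNc⟩ := Nat.sSup_mem hKn hKb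
  refine ⟨N, hcard N hN, hN.1, fun x hx => ?_⟩
  by_contra! hfar
  have hxN : x ∉ N := fun h => by
    have := hfar x h
    norm_num at this
  have hP : P (insert x N) := by
    refine ⟨fun p hp => ?_, fun p hp q hq hpq => ?_⟩
    · rcases Finset.mem_insert.1 hp with rfl | hp
      exacts [hx, hN.1 p hp]
    · rcases Finset.mem_insert.1 hp with hpx | hp <;> rcases Finset.mem_insert.1 hq with hqx | hq
      · exact absurd (hpx.trans hqx.symm) hpq
      · rw [hpx]
        exact (hfar q hq).le
      · rw [hqx, norm_sub_rev]
        exact (hfar p hp).le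
      · exact hN.2 p hp q hq hpq
  have := le_csSup hKb ⟨_, hP, rfl⟩
  rw [Finset.card_insert_of_notMem hxN, ← hNc] at this
  omega

/-- Replacing a unit vector by a nearby net point costs at most `‖G‖ / 2`, which the left-hand side
absorbs. -/
lemma opNorm_le_of_half_net {E F : Type*} [NormedAddCommGroup E] [NormedSpace ℝ E]
    [NormedAddCommGroup F] [NormedSpace ℝ F] {N : Set E}
    (hN : ∀ x : E, ‖x‖ ≤ 1 → ∃ p ∈ N, ‖x - p‖ ≤ 1 / 2) (G : E →L[ℝ] F) {b : ℝ}
    (hG : ∀ p ∈ N, ‖G p‖ ≤ b) : ‖G‖ ≤ 2 * b := by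
  obtain ⟨p₀, hp₀, -⟩ := hN 0 (by simp)
  have hb : 0 ≤ b := (norm_nonneg _).trans (hG p₀ hp₀)
  have key : ‖G‖ ≤ b + ‖G‖ * (1 / 2) := by
    refine G.opNorm_le_of_unit_norm (by positivity) fun x hx => ?_
    obtain ⟨p, hp, hxp⟩ := hN x hx.le
    calc ‖G x‖ = ‖G p + G (x - p)‖ := by rw [← map_add, add_sub_cancel]
      _ ≤ ‖G p‖ + ‖G (x - p)‖ := norm_add_le _ _
      _ ≤ b + ‖G‖ * (1 / 2) := add_le_add (hG p hp) ((G.le_opNorm _).trans (by gcongr))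
  linarith

/-- A bilinear form is controlled on the range of an isometry by its values on a net of the unit
ball. -/
lemma exists_net_bilinear_of_isometry {E V : Type*} [NormedAddCommGroup E] [NormedSpace ℝ E]
    [FiniteDimensional ℝ E] [NormedAddCommGroup V] [NormedSpace ℝ V] (ι : E →ₗᵢ[ℝ] V) :
    ∃ N : Finset V, N.card ≤ 5 ^ Module.finrank ℝ E ∧ (∀ p ∈ N, ‖p‖ ≤ 1) ∧
      ∀ (b : V →L[ℝ] V →L[ℝ] ℝ) (δ : ℝ),
        (∀ p ∈ N, ∀ q ∈ N, |b p q| ≤ δ) → ∀ x : E, |b (ι x) (ι x)| ≤ 4 * δ * ‖x‖ ^ 2 := by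
  classical
  obtain ⟨N, hc, h1, hN⟩ := exists_half_net E
  refine ⟨N.image ι, Finset.card_image_le.trans hc, ?_, fun b δ hb x => ?_⟩
  · simp only [Finset.forall_mem_image, ι.norm_map]
    exact fun p hp => h1 p hp
  · simp only [Finset.forall_mem_image] at hb
    set b' : E →L[ℝ] E →L[ℝ] ℝ :=
      b.bilinearComp ι.toContinuousLinearMap ι.toContinuousLinearMap with hb'
    have hn : ‖b'‖ ≤ 2 * (2 * δ) := opNorm_le_of_half_net (N := N) hN b' fun p hp =>
      opNorm_le_of_half_net (N := N) hN (b' p) fun q hq => hb hp hq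
    calc |b (ι x) (ι x)| ≤ ‖b'‖ * ‖x‖ * ‖x‖ := b'.le_opNorm₂ x x
      _ ≤ 2 * (2 * δ) * ‖x‖ * ‖x‖ := by gcongr
      _ = 4 * δ * ‖x‖ ^ 2 := by ring

/-- A bilinear form is controlled on the vectors supported in `S` by its values on a net of
cardinality at most `5 ^ #S`. -/
lemma exists_net_bilinear_of_support {d : ℕ} (S : Finset (Fin d)) :
    ∃ N : Finset (EuclideanSpace ℝ (Fin d)), N.card ≤ 5 ^ S.card ∧ (∀ p ∈ N, ‖p‖ ≤ 1) ∧
      ∀ (b : EuclideanSpace ℝ (Fin d) →L[ℝ] EuclideanSpace ℝ (Fin d) →L[ℝ] ℝ) (δ : ℝ),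
        (∀ p ∈ N, ∀ q ∈ N, |b p q| ≤ δ) →
          ∀ x : EuclideanSpace ℝ (Fin d), (∀ j ∉ S, x j = 0) → |b x x| ≤ 4 * δ * ‖x‖ ^ 2 := by
  classical
  let e : Fin d → EuclideanSpace ℝ (Fin d) := fun j => EuclideanSpace.single j 1
  let W : Submodule ℝ (EuclideanSpace ℝ (Fin d)) := Submodule.span ℝ (S.image e : Set _)
  obtain ⟨N, hc, h1, hN⟩ := exists_net_bilinear_of_isometry (E := W) W.subtypeₗᵢ
  refine ⟨N, hc.trans (pow_le_pow_right₀ (by norm_num) ?_), h1, fun b δ hb x hx => ?_⟩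
  · exact (finrank_span_finset_le_card _).trans Finset.card_image_le
  · have hmem : x ∈ Submodule.span ℝ (S.image e : Set (EuclideanSpace ℝ (Fin d))) := by
      have hsum : x = ∑ j ∈ S, x j • e j := by
        ext i
        simp only [WithLp.ofLp_sum, Finset.sum_apply, PiLp.smul_apply, e, smul_eq_mul,
          PiLp.single_apply, mul_ite, mul_one, mul_zero, Finset.sum_ite_eq]
        split_ifs with h
        · rfl
        · exact hx i h
      rw [hsum]
      exact Submodule.sum_mem _ fun j hj => Submodule.smul_mem _ _
        (Submodule.subset_span (Finset.mem_coe.2 (Finset.mem_image_of_mem e hj)))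
    exact hN b δ hb ⟨x, hmem⟩

/-! ### Sub-Gaussian variables and concentration of their squares -/

section Scalar

variable {Ω : Type*} [MeasurableSpace Ω] {μ : Measure Ω}

/-- The linear term is kept because it integrates to zero for centered variables; only the quadratic
remainder then enters the moment generating function. -/
lemma exp_le_one_add_add_sq_mul_exp_abs (u : ℝ) :
    Real.exp u ≤ 1 + u + u ^ 2 * Real.exp |u| := by
  have h := Complex.norm_exp_sub_sum_le_norm_mul_exp (u : ℂ) 2
  have h1 : Complex.exp u - ∑ m ∈ Finset.range 2, (u : ℂ) ^ m / m.factorial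
      = ((Real.exp u - (1 + u) : ℝ) : ℂ) := by
    simp [Finset.sum_range_succ]
  rw [h1, Complex.norm_real, Complex.norm_real, Real.norm_eq_abs, Real.norm_eq_abs, sq_abs] at h
  linarith [le_abs_self (Real.exp u - (1 + u))]

/-- The sub-Gaussian tail bound yields an exponential moment of the square. -/
lemma integral_exp_sq_le_of_tail [IsProbabilityMeasure μ] {X : Ω → ℝ} (hX : AEMeasurable X μ)
    {c : ℝ} (hc : 0 < c)
    (h : ∀ z : ℝ, 0 ≤ z → μ.real {ω | z < |X ω|} ≤ 2 * Real.exp (-z ^ 2 / (2 * c))) :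
    Integrable (fun ω => Real.exp (X ω ^ 2 / (4 * c))) μ ∧
      ∫ ω, Real.exp (X ω ^ 2 / (4 * c)) ∂μ ≤ 3 := by
  have hm : AEMeasurable (fun ω => Real.exp (X ω ^ 2 / (4 * c))) μ := by fun_prop
  have hint : ∫⁻ t in Set.Ioi (1 : ℝ), ENNReal.ofReal (2 * t ^ (-2 : ℝ)) = ENNReal.ofReal 2 := by
    rw [← ofReal_integral_eq_lintegral_ofReal, integral_const_mul,
      integral_Ioi_rpow_of_lt (by norm_num) (by norm_num)]
    · norm_num
    · exact (integrableOn_Ioi_rpow_of_lt (by norm_num) (by norm_num)).const_mul 2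
    · filter_upwards [ae_restrict_mem measurableSet_Ioi] with t ht
      have : (0 : ℝ) < t := lt_trans one_pos ht
      positivity
  -- Taking `z ^ 2 = 4 * c * log t` turns the Gaussian tail into `2 * t ^ (-2)`, of integral 2 over
  -- `t > 1`; levels `t ≤ 1` contribute at most 1, whence the bound 3.
  have htail : ∀ t ∈ Set.Ioi (1 : ℝ), μ {ω | t < Real.exp (X ω ^ 2 / (4 * c))} ≤
      ENNReal.ofReal (2 * t ^ (-2 : ℝ)) := by
    intro t ht
    have ht0 : 0 < t := lt_trans one_pos ht
    have hlog : 0 ≤ 4 * c * Real.log t := by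
      have := Real.log_nonneg (le_of_lt ht)
      positivity
    have hsub : {ω | t < Real.exp (X ω ^ 2 / (4 * c))} ⊆
        {ω | Real.sqrt (4 * c * Real.log t) < |X ω|} := by
      intro ω hω
      have h1 := (Real.log_lt_iff_lt_exp ht0).2 hω
      rw [lt_div_iff₀ (by positivity)] at h1
      change Real.sqrt _ < _
      rw [← Real.sqrt_sq_eq_abs]
      exact Real.sqrt_lt_sqrt hlog (by linarith)
    refine (measure_mono hsub).trans ?_
    rw [← ofReal_measureReal]
    refine ENNReal.ofReal_le_ofReal ((h _ (Real.sqrt_nonneg _)).trans_eq ?_)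
    rw [Real.sq_sqrt hlog, Real.rpow_def_of_pos ht0]
    congr 2
    field_simp
    ring
  have hle : ∫⁻ ω, ENNReal.ofReal (Real.exp (X ω ^ 2 / (4 * c))) ∂μ ≤ 3 := by
    rw [lintegral_eq_lintegral_meas_lt μ (ae_of_all _ fun ω => (Real.exp_pos _).le) hm,
      ← Set.Ioc_union_Ioi_eq_Ioi (zero_le_one' ℝ),
      lintegral_union measurableSet_Ioi (Set.Ioc_disjoint_Ioi le_rfl)]
    calc _ ≤ (∫⁻ _ in Set.Ioc (0 : ℝ) 1, 1)
          + ∫⁻ t in Set.Ioi (1 : ℝ), ENNReal.ofReal (2 * t ^ (-2 : ℝ)) := by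
            refine add_le_add (lintegral_mono fun t => prob_le_one) ?_
            exact setLIntegral_mono' measurableSet_Ioi htail
      _ = 3 := by
            rw [hint]
            norm_num
  have hi : Integrable (fun ω => Real.exp (X ω ^ 2 / (4 * c))) μ := by
    refine ⟨hm.aestronglyMeasurable, ?_⟩
    rw [hasFiniteIntegral_iff_ofReal (ae_of_all _ fun ω => (Real.exp_pos _).le)]
    exact hle.trans_lt (by norm_num)
  refine ⟨hi, ?_⟩
  rw [integral_eq_lintegral_of_nonneg_ae (ae_of_all _ fun ω => (Real.exp_pos _).le) hi.1]
  exact ENNReal.toReal_le_of_le_ofReal (by norm_num) (hle.trans (by norm_num))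

lemma integral_exp_sq_le_of_hasSubgaussianMGF [IsProbabilityMeasure μ] {X : Ω → ℝ} {c : NNReal}
    (hc : 0 < c) (h : HasSubgaussianMGF X c μ) :
    Integrable (fun ω => Real.exp (X ω ^ 2 / (4 * c))) μ ∧
      ∫ ω, Real.exp (X ω ^ 2 / (4 * c)) ∂μ ≤ 3 := by
  refine integral_exp_sq_le_of_tail h.aemeasurable (c := (c : ℝ)) hc fun z hz => ?_
  have hsub : {ω | z < |X ω|} ⊆ {ω | z ≤ X ω} ∪ {ω | z ≤ (-X) ω} := by
    intro ω hω
    rcases lt_abs.1 (show z < |X ω| from hω) with h | h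
    exacts [Or.inl h.le, Or.inr h.le]
  calc μ.real {ω | z < |X ω|} ≤ μ.real {ω | z ≤ X ω} + μ.real {ω | z ≤ (-X) ω} :=
        (measureReal_mono hsub).trans (measureReal_union_le _ _)
    _ ≤ _ := by linarith [h.measure_ge_le hz, h.neg.measure_ge_le hz]

/-- Centering removes the linear term of `exp (t * X)`. In the remainder, `x ^ 2` costs `exp (x ^ 2
/ (8 * c))` and, by AM-GM, `|t * x|` costs `x ^ 2 / (16 * c)` in the exponent; together they stay
within `x ^ 2 / (4 * c)`. -/
lemma hasSubgaussianMGF_of_integral_exp_sq_le [IsProbabilityMeasure μ] {X : Ω → ℝ}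
    (hX : Integrable X μ) (h0 : ∫ ω, X ω ∂μ = 0) {c : NNReal} (hc : 0 < c)
    (hi : Integrable (fun ω => Real.exp (X ω ^ 2 / (4 * c))) μ)
    (h3 : ∫ ω, Real.exp (X ω ^ 2 / (4 * c)) ∂μ ≤ 3) :
    HasSubgaussianMGF X (56 * c) μ := by
  have hc' : (0 : ℝ) < c := hc
  have hpt : ∀ t x : ℝ, Real.exp (t * x) ≤ 1 + t * x +
      8 * c * t ^ 2 * Real.exp (4 * c * t ^ 2) * Real.exp (x ^ 2 / (4 * c)) := by
    intro t x
    have h1 : |t * x| ≤ 4 * c * t ^ 2 + x ^ 2 / (16 * c) := by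
      rw [abs_le]
      have e : x ^ 2 / (16 * c) = 4 * c * (x / (8 * c)) ^ 2 := by field_simp; ring
      have e2 : t * x = 8 * c * t * (x / (8 * c)) := by field_simp
      rw [e, e2]
      constructor
      · nlinarith [mul_nonneg hc'.le (sq_nonneg (t + x / (8 * c)))]
      · nlinarith [mul_nonneg hc'.le (sq_nonneg (t - x / (8 * c)))]
    have h2 : x ^ 2 ≤ 8 * c * Real.exp (x ^ 2 / (8 * c)) := by
      have := Real.add_one_le_exp (x ^ 2 / (8 * c))
      have e : x ^ 2 = 8 * c * (x ^ 2 / (8 * c)) := by field_simp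
      calc x ^ 2 = 8 * c * (x ^ 2 / (8 * c)) := e
        _ ≤ _ := by gcongr; linarith
    refine (exp_le_one_add_add_sq_mul_exp_abs _).trans (add_le_add le_rfl ?_)
    calc (t * x) ^ 2 * Real.exp |t * x|
        ≤ t ^ 2 * (8 * c * Real.exp (x ^ 2 / (8 * c)))
          * Real.exp (4 * c * t ^ 2 + x ^ 2 / (16 * c)) := by
          rw [mul_pow]
          gcongr
      _ = 8 * c * t ^ 2 * Real.exp (4 * c * t ^ 2) *
          Real.exp (x ^ 2 / (8 * c) + x ^ 2 / (16 * c)) := by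
          rw [Real.exp_add, Real.exp_add]
          ring
      _ ≤ _ := by
          gcongr
          have : 0 ≤ x ^ 2 / c := by positivity
          have e1 : x ^ 2 / (8 * c) = x ^ 2 / c / 8 := by field_simp
          have e2 : x ^ 2 / (16 * c) = x ^ 2 / c / 16 := by field_simp
          have e3 : x ^ 2 / (4 * c) = x ^ 2 / c / 4 := by field_simp
          rw [e1, e2, e3]
          linarith
  have hlin : ∀ t : ℝ, Integrable (fun ω => 1 + t * X ω) μ := fun t =>
    (integrable_const _).add (hX.const_mul t)
  have hdom : ∀ t : ℝ, Integrable (fun ω => 1 + t * X ω +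
      8 * c * t ^ 2 * Real.exp (4 * c * t ^ 2) * Real.exp (X ω ^ 2 / (4 * c))) μ := fun t =>
    (hlin t).add (hi.const_mul _)
  have hint : ∀ t : ℝ, Integrable (fun ω => Real.exp (t * X ω)) μ := by
    intro t
    refine (hdom t).mono' ?_ (ae_of_all _ fun ω => ?_)
    · exact Real.continuous_exp.comp_aestronglyMeasurable (hX.1.const_mul t)
    · rw [Real.norm_of_nonneg (Real.exp_pos _).le]
      exact hpt t (X ω)
  refine ⟨hint, fun t => ?_⟩
  have h1 : mgf X μ t ≤ 1 + 8 * c * t ^ 2 * Real.exp (4 * c * t ^ 2) * 3 := by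
    calc mgf X μ t ≤ ∫ ω, (1 + t * X ω +
          8 * c * t ^ 2 * Real.exp (4 * c * t ^ 2) * Real.exp (X ω ^ 2 / (4 * c))) ∂μ :=
          integral_mono (hint t) (hdom t) fun ω => hpt t (X ω)
      _ = 1 + 8 * c * t ^ 2 * Real.exp (4 * c * t ^ 2)
          * ∫ ω, Real.exp (X ω ^ 2 / (4 * c)) ∂μ := by
          rw [integral_add (hlin t) (hi.const_mul _),
            integral_add (integrable_const _) (hX.const_mul t), integral_const_mul,
            integral_const_mul, h0]
          simp
      _ ≤ _ := by gcongr
  refine h1.trans ?_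
  have hw : 0 ≤ 4 * c * t ^ 2 := by positivity
  set w : ℝ := 4 * c * t ^ 2 with hwdef
  -- The final exponent is `7 * w = 28 * c * t ^ 2`, which is where 56 comes from.
  calc 1 + 8 * c * t ^ 2 * Real.exp w * 3 ≤ Real.exp w * (6 * w + 1) := by
        have := Real.one_le_exp hw
        rw [show (8 : ℝ) * c * t ^ 2 = 2 * w by rw [hwdef]; ring]
        linarith
    _ ≤ Real.exp w * Real.exp (6 * w) := by gcongr; exact Real.add_one_le_exp _
    _ = Real.exp (((56 * c : NNReal) : ℝ) * t ^ 2 / 2) := by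
        rw [← Real.exp_add, hwdef]
        push_cast
        congr 1
        ring

/-- Merges the two alternative definitions: only the tail version needs the factor 56, the other is
weakened to match. -/
lemma IsSubGaussian.hasSubgaussianMGF [IsProbabilityMeasure μ] {X : Ω → ℝ} {σ : ℝ} (hσ : 0 < σ)
    (h : IsSubGaussian X σ μ) : HasSubgaussianMGF X (56 * (σ ^ 2).toNNReal) μ := by
  obtain ⟨hX, h0, h⟩ := h
  have hc : (((σ ^ 2).toNNReal : NNReal) : ℝ) = σ ^ 2 := Real.coe_toNNReal _ (sq_nonneg σ)
  have hc0 : 0 < (σ ^ 2).toNNReal := by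
    rw [Real.toNNReal_pos]
    positivity
  rcases h with h | h
  · refine ⟨fun t => by simpa only [mul_comm] using (h t).1, fun t => ?_⟩
    have h1 : mgf X μ t ≤ Real.exp (σ ^ 2 * t ^ 2 / 2) := by
      simpa only [mgf, mul_comm (X _)] using (h t).2
    refine h1.trans (Real.exp_le_exp.2 ?_)
    push_cast
    rw [hc]
    have : 0 ≤ σ ^ 2 * t ^ 2 := by positivity
    linarith
  · have h' := integral_exp_sq_le_of_tail hX.aemeasurable
      (c := (((σ ^ 2).toNNReal : NNReal) : ℝ)) hc0 (by simpa only [hc] using h)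
    exact hasSubgaussianMGF_of_integral_exp_sq_le hX h0 hc0 h'.1 h'.2

/-- A variable whose square has an exponential moment has a square that is, once centered,
sub-exponential. -/
lemma integral_exp_mul_sq_sub_le [IsProbabilityMeasure μ] {X : Ω → ℝ} (hX : AEMeasurable X μ)
    {c v : ℝ} (hc : 0 < c)
    (hi : Integrable (fun ω => Real.exp (X ω ^ 2 / (4 * c))) μ)
    (h3 : ∫ ω, Real.exp (X ω ^ 2 / (4 * c)) ∂μ ≤ 3)
    (hv : ∫ ω, X ω ^ 2 ∂μ = v) :
    v ≤ 8 * c ∧ ∀ s : ℝ, |s| ≤ 1 / (8 * c) →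
      Integrable (fun ω => Real.exp (s * (X ω ^ 2 - v))) μ ∧
      ∫ ω, Real.exp (s * (X ω ^ 2 - v)) ∂μ ≤ Real.exp (3072 * c ^ 2 * s ^ 2) := by
  have hsq : ∀ x : ℝ, x ^ 2 ≤ 4 * c * (Real.exp (x ^ 2 / (4 * c)) - 1) := by
    intro x
    have := Real.add_one_le_exp (x ^ 2 / (4 * c))
    calc x ^ 2 = 4 * c * (x ^ 2 / (4 * c)) := by field_simp
      _ ≤ _ := by gcongr; linarith
  have hdom : Integrable (fun ω => 4 * c * (Real.exp (X ω ^ 2 / (4 * c)) - 1)) μ :=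
    (hi.sub (integrable_const _)).const_mul _
  have hX2 : Integrable (fun ω => X ω ^ 2) μ := by
    refine hdom.mono' (hX.pow_const 2).aestronglyMeasurable (ae_of_all _ fun ω => ?_)
    rw [Real.norm_of_nonneg (sq_nonneg _)]
    exact hsq _
  have hv8 : v ≤ 8 * c := by
    rw [← hv]
    calc ∫ ω, X ω ^ 2 ∂μ ≤ ∫ ω, 4 * c * (Real.exp (X ω ^ 2 / (4 * c)) - 1) ∂μ :=
          integral_mono hX2 hdom fun ω => hsq _
      _ = 4 * c * (∫ ω, Real.exp (X ω ^ 2 / (4 * c)) ∂μ - 1) := by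
          rw [integral_const_mul, integral_sub hi (integrable_const _)]
          simp
      _ ≤ 4 * c * (3 - 1) := by gcongr
      _ = 8 * c := by ring
  have hv0 : 0 ≤ v := hv ▸ integral_nonneg fun ω => sq_nonneg _
  refine ⟨hv8, fun s hs => ?_⟩
  have he2 : Real.exp (v / (4 * c)) ≤ 8 := by
    have h1 : v / (4 * c) ≤ 1 + 1 := by
      rw [div_le_iff₀ (by positivity)]
      linarith
    have h2 : Real.exp 1 ≤ 2.8 := by linarith [Real.exp_one_lt_d9]
    calc Real.exp (v / (4 * c)) ≤ Real.exp 1 * Real.exp 1 := by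
          rw [← Real.exp_add]
          exact Real.exp_le_exp.2 h1
      _ ≤ 2.8 * 2.8 := by gcongr
      _ ≤ 8 := by norm_num
  have hpt : ∀ x : ℝ, Real.exp (s * (x ^ 2 - v)) ≤
      1 + s * (x ^ 2 - v) + 1024 * c ^ 2 * s ^ 2 * Real.exp (x ^ 2 / (4 * c)) := by
    intro x
    have hT0 : 0 ≤ x ^ 2 + v := by positivity
    -- Both `T ^ 2` and the exponential factor cost `exp (T / (8 * c))`. Their product `exp (T / (4
    -- * c))` splits into `exp (v / (4 * c)) ≤ 8` and the integrable `exp (x ^ 2 / (4 * c))`.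
    set T : ℝ := x ^ 2 + v with hT
    have hW : |x ^ 2 - v| ≤ T := by
      rw [abs_le]
      constructor <;> nlinarith [sq_nonneg x]
    have h1 : |s * (x ^ 2 - v)| ≤ T / (8 * c) := by
      rw [abs_mul]
      calc |s| * |x ^ 2 - v| ≤ 1 / (8 * c) * T := by gcongr
        _ = T / (8 * c) := by ring
    have h2 : T ^ 2 ≤ 128 * c ^ 2 * Real.exp (T / (8 * c)) := by
      have := Real.pow_div_factorial_le_exp (x := T / (8 * c)) (by positivity) 2
      calc T ^ 2 = 128 * c ^ 2 * ((T / (8 * c)) ^ 2 / (Nat.factorial 2)) := by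
            norm_num [Nat.factorial]
            field_simp
            ring
        _ ≤ _ := by gcongr
    refine (exp_le_one_add_add_sq_mul_exp_abs _).trans (add_le_add le_rfl ?_)
    calc (s * (x ^ 2 - v)) ^ 2 * Real.exp |s * (x ^ 2 - v)|
        ≤ (s ^ 2 * (128 * c ^ 2 * Real.exp (T / (8 * c)))) * Real.exp (T / (8 * c)) := by
          have : (x ^ 2 - v) ^ 2 ≤ T ^ 2 := sq_le_sq' (abs_le.1 hW).1 (abs_le.1 hW).2
          rw [mul_pow]
          gcongr
          exact this.trans h2
      _ = 128 * c ^ 2 * s ^ 2 * (Real.exp (v / (4 * c)) * Real.exp (x ^ 2 / (4 * c))) := by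
          have : Real.exp (T / (8 * c)) * Real.exp (T / (8 * c))
              = Real.exp (v / (4 * c)) * Real.exp (x ^ 2 / (4 * c)) := by
            rw [← Real.exp_add, ← Real.exp_add, hT]
            congr 1
            field_simp
            ring
          rw [← this]
          ring
      _ ≤ 128 * c ^ 2 * s ^ 2 * (8 * Real.exp (x ^ 2 / (4 * c))) := by gcongr
      _ = _ := by ring
  have hsub : Integrable (fun ω => s * (X ω ^ 2 - v)) μ :=
    (hX2.sub (integrable_const _)).const_mul s
  have hlin : Integrable (fun ω => 1 + s * (X ω ^ 2 - v)) μ := (integrable_const _).add hsub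
  have hdi : Integrable (fun ω => 1 + s * (X ω ^ 2 - v)
      + 1024 * c ^ 2 * s ^ 2 * Real.exp (X ω ^ 2 / (4 * c))) μ :=
    hlin.add (hi.const_mul _)
  have hint : Integrable (fun ω => Real.exp (s * (X ω ^ 2 - v))) μ := by
    refine hdi.mono' (by fun_prop) (ae_of_all _ fun ω => ?_)
    rw [Real.norm_of_nonneg (Real.exp_pos _).le]
    exact hpt _
  refine ⟨hint, ?_⟩
  calc ∫ ω, Real.exp (s * (X ω ^ 2 - v)) ∂μ ≤ ∫ ω, (1 + s * (X ω ^ 2 - v)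
        + 1024 * c ^ 2 * s ^ 2 * Real.exp (X ω ^ 2 / (4 * c))) ∂μ :=
        integral_mono hint hdi fun ω => hpt _
    _ = 1 + 1024 * c ^ 2 * s ^ 2 * ∫ ω, Real.exp (X ω ^ 2 / (4 * c)) ∂μ := by
        rw [integral_add hlin (hi.const_mul _), integral_add (integrable_const _) hsub,
          integral_const_mul, integral_const_mul, integral_sub hX2 (integrable_const _), hv]
        simp
    _ ≤ 1 + 1024 * c ^ 2 * s ^ 2 * 3 := by gcongr
    _ = 3072 * c ^ 2 * s ^ 2 + 1 := by ring
    _ ≤ _ := Real.add_one_le_exp _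

/-- Chernoff bound for a sum of independent variables with a common bound on the moment generating
function at `s`. -/
lemma measureReal_sum_ge_le [IsProbabilityMeasure μ] {n : ℕ} {W : Fin n → Ω → ℝ}
    (hW : iIndepFun W μ) (hm : ∀ i, Measurable (W i)) {s t r : ℝ} (hs : 0 ≤ s)
    (hi : ∀ i, Integrable (fun ω => Real.exp (s * W i ω)) μ)
    (hr : ∀ i, mgf (W i) μ s ≤ Real.exp r) :
    μ.real {ω | n * t ≤ ∑ i, W i ω} ≤ Real.exp (-(s * t - r) * n) := by
  have h1 := measure_ge_le_exp_mul_mgf (μ := μ) (X := ∑ i, W i) (n * t) hs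
    (hW.integrable_exp_mul_sum hm fun i _ => hi i)
  rw [hW.mgf_sum hm] at h1
  simp only [Finset.sum_apply] at h1
  refine h1.trans ?_
  calc Real.exp (-s * (n * t)) * ∏ i, mgf (W i) μ s
      ≤ Real.exp (-s * (n * t)) * ∏ _i : Fin n, Real.exp r := by
        gcongr with i
        · exact fun _ _ => mgf_nonneg
        · exact hr i
    _ = _ := by
        rw [Finset.prod_const, Finset.card_univ, Fintype.card_fin, ← Real.exp_nat_mul,
          ← Real.exp_add]
        congr 1
        ring

/-- Concentration of a sum of squares of independent sub-Gaussian variables with common second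
moment `v`. -/
lemma measureReal_abs_sum_sq_sub_gt_le [IsProbabilityMeasure μ] {n : ℕ} {X : Fin n → Ω → ℝ}
    (hX : iIndepFun X μ) (hm : ∀ i, Measurable (X i)) {c : NNReal} {v : ℝ} (hc : 0 < c)
    (hsub : ∀ i, HasSubgaussianMGF (X i) c μ) (hv : ∀ i, ∫ ω, X i ω ^ 2 ∂μ = v) :
    μ.real {ω | n * (v / 8) < |∑ i, X i ω ^ 2 - n * v|} ≤
      2 * Real.exp (-(v ^ 2 / (786432 * c ^ 2)) * n) := by
  rcases Nat.eq_zero_or_pos n with rfl | hn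
  · simp
  have hc' : (0 : ℝ) < c := hc
  have hsq := fun i => integral_exp_mul_sq_sub_le (hm i).aemeasurable hc'
    (integral_exp_sq_le_of_hasSubgaussianMGF hc (hsub i)).1
    (integral_exp_sq_le_of_hasSubgaussianMGF hc (hsub i)).2 (hv i)
  have hv8 : v ≤ 8 * c := (hsq ⟨0, hn⟩).1
  have hv0 : 0 ≤ v := hv ⟨0, hn⟩ ▸ integral_nonneg fun ω => sq_nonneg _
  -- This value maximizes the Chernoff exponent `s * (v / 8) - 3072 * c ^ 2 * s ^ 2`; it is
  -- admissible because `v ≤ 8 * c`.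
  have hs0 : 0 ≤ v / (49152 * (c : ℝ) ^ 2) := by positivity
  have hs8 : v / (49152 * (c : ℝ) ^ 2) ≤ 1 / (8 * c) := by
    rw [div_le_div_iff₀ (by positivity) (by positivity)]
    nlinarith
  set s : ℝ := v / (49152 * (c : ℝ) ^ 2) with hs
  have hr : s * (v / 8) - 3072 * (c : ℝ) ^ 2 * s ^ 2 = v ^ 2 / (786432 * c ^ 2) := by
    rw [hs]
    field_simp
    ring
  have hup := measureReal_sum_ge_le (μ := μ) (W := fun i ω => X i ω ^ 2 - v) (t := v / 8)
    (r := 3072 * (c : ℝ) ^ 2 * s ^ 2)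
    (hX.comp (fun _ x => x ^ 2 - v) fun _ => by fun_prop) (fun i => by fun_prop) hs0
    (fun i => ((hsq i).2 s (by rwa [abs_of_nonneg hs0])).1)
    (fun i => ((hsq i).2 s (by rwa [abs_of_nonneg hs0])).2)
  have hneg : |-s| ≤ 1 / (8 * (c : ℝ)) := by rwa [abs_neg, abs_of_nonneg hs0]
  have hexp : ∀ i ω, s * -(X i ω ^ 2 - v) = -s * (X i ω ^ 2 - v) := fun i ω => by ring
  have hlo := measureReal_sum_ge_le (μ := μ) (W := fun i ω => -(X i ω ^ 2 - v)) (t := v / 8)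
    (r := 3072 * (c : ℝ) ^ 2 * s ^ 2)
    (hX.comp (fun _ x => -(x ^ 2 - v)) fun _ => by fun_prop) (fun i => by fun_prop) hs0
    (fun i => by simpa only [hexp] using ((hsq i).2 (-s) hneg).1)
    (fun i => by simpa only [mgf, hexp, neg_sq] using ((hsq i).2 (-s) hneg).2)
  rw [hr] at hup hlo
  have hset : {ω | n * (v / 8) < |∑ i, X i ω ^ 2 - n * v|} ⊆
      {ω | n * (v / 8) ≤ ∑ i, (X i ω ^ 2 - v)} ∪ {ω | n * (v / 8) ≤ ∑ i, -(X i ω ^ 2 - v)} := by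
    intro ω hω
    have e : ∑ i, (X i ω ^ 2 - v) = ∑ i, X i ω ^ 2 - n * v := by
      simp [Finset.sum_sub_distrib]
    rcases lt_abs.1 (show n * (v / 8) < |∑ i, X i ω ^ 2 - n * v| from hω) with h | h
    · exact Or.inl (by simpa only [Set.mem_ofPred_eq, e] using h.le)
    · exact Or.inr (by simpa only [Set.mem_ofPred_eq, Finset.sum_neg_distrib, e] using h.le)
  calc _ ≤ _ := (measureReal_mono hset).trans (measureReal_union_le _ _)
    _ ≤ _ := by linarith

end Scalar

/-! ### Deviation of the Gram form on sparse vectors -/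

/-- The deviation of `‖M x‖ ^ 2` from `w * ‖x‖ ^ 2`. -/
noncomputable def gramDeviation {n d : ℕ} (M : Matrix (Fin n) (Fin d) ℝ) (w : ℝ)
    (x : EuclideanSpace ℝ (Fin d)) : ℝ :=
  ∑ i, (∑ j, M i j * x j) ^ 2 - w * ‖x‖ ^ 2

/-- The bilinear form that polarizes `gramDeviation`. -/
noncomputable def gramDeviationBilin {n d : ℕ} (M : Matrix (Fin n) (Fin d) ℝ) (w : ℝ) :
    EuclideanSpace ℝ (Fin d) →L[ℝ] EuclideanSpace ℝ (Fin d) →L[ℝ] ℝ :=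
  ∑ i, (innerSL ℝ (WithLp.toLp 2 (M i))).smulRight (innerSL ℝ (WithLp.toLp 2 (M i)))
    - w • ∑ j : Fin d, (EuclideanSpace.proj j : EuclideanSpace ℝ (Fin d) →L[ℝ] ℝ).smulRight
        (EuclideanSpace.proj j : EuclideanSpace ℝ (Fin d) →L[ℝ] ℝ)

lemma gramDeviationBilin_apply {n d : ℕ} (M : Matrix (Fin n) (Fin d) ℝ) (w : ℝ)
    (x y : EuclideanSpace ℝ (Fin d)) :
    gramDeviationBilin M w x y =
      ∑ i, (∑ j, M i j * x j) * (∑ j, M i j * y j) - w * inner ℝ x y := by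
  have h : ∀ (i : Fin n) (z : EuclideanSpace ℝ (Fin d)),
      inner ℝ (WithLp.toLp 2 (M i)) z = ∑ j, M i j * z j := by
    intro i z
    rw [PiLp.inner_apply]
    exact Finset.sum_congr rfl fun j _ => mul_comm _ _
  have hxy : inner ℝ x y = ∑ j, x j * y j := by
    rw [PiLp.inner_apply]
    exact Finset.sum_congr rfl fun j _ => mul_comm _ _
  simp [gramDeviationBilin, h, hxy]

lemma gramDeviationBilin_self {n d : ℕ} (M : Matrix (Fin n) (Fin d) ℝ) (w : ℝ)
    (x : EuclideanSpace ℝ (Fin d)) : gramDeviationBilin M w x x = gramDeviation M w x := by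
  rw [gramDeviationBilin_apply, gramDeviation, real_inner_self_eq_norm_sq]
  simp only [sq]

lemma gramDeviationBilin_eq_polarization {n d : ℕ} (M : Matrix (Fin n) (Fin d) ℝ) (w : ℝ)
    (x y : EuclideanSpace ℝ (Fin d)) :
    gramDeviationBilin M w x y =
      (gramDeviation M w (x + y) - gramDeviation M w (x - y)) / 4 := by
  have hsymm : gramDeviationBilin M w y x = gramDeviationBilin M w x y := by
    simp only [gramDeviationBilin_apply, real_inner_comm, mul_comm]
  simp only [← gramDeviationBilin_self, map_add, map_sub, add_apply,
    sub_apply, hsymm]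
  ring

/-- Finitely many test vectors control the deviation on all `s`-sparse vectors. -/
lemma exists_test_vectors {d s : ℕ} (hs : 0 < s) (hsd : s ≤ d) :
    ∃ T : Finset (EuclideanSpace ℝ (Fin d)), T.card ≤ d.choose s * 50 ^ s ∧
      ∀ (n : ℕ) (M : Matrix (Fin n) (Fin d) ℝ) (w δ : ℝ), 0 ≤ δ →
        (∀ p ∈ T, |gramDeviation M w p| ≤ δ * ‖p‖ ^ 2) →
          ∀ x : EuclideanSpace ℝ (Fin d), hammingNorm x.ofLp ≤ s →
            |gramDeviation M w x| ≤ 4 * δ * ‖x‖ ^ 2 := by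
  classical
  choose N hNc hN1 hN using exists_net_bilinear_of_support (d := d)
  refine ⟨(Finset.powersetCard s Finset.univ).biUnion fun S =>
    Finset.image₂ (· + ·) (N S) (N S) ∪ Finset.image₂ (· - ·) (N S) (N S), ?_, ?_⟩
  · refine (Finset.card_biUnion_le_card_mul _ _ (50 ^ s) fun S hS => ?_).trans_eq (by simp)
    have hcard := hNc S
    rw [(Finset.mem_powersetCard.1 hS).2] at hcard
    have hprod : (N S).card * (N S).card ≤ 25 ^ s := by
      calc (N S).card * (N S).card ≤ 5 ^ s * 5 ^ s := Nat.mul_le_mul hcard hcard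
        _ = 25 ^ s := by rw [← mul_pow]; norm_num
    calc _ ≤ (N S).card * (N S).card + (N S).card * (N S).card :=
          (Finset.card_union_le _ _).trans
            (add_le_add (Finset.card_image₂_le _ _ _) (Finset.card_image₂_le _ _ _))
      _ ≤ 2 * 25 ^ s := by omega
      _ ≤ 2 ^ s * 25 ^ s := by gcongr; exact Nat.le_self_pow hs.ne' 2
      _ = 50 ^ s := by rw [← mul_pow]; norm_num
  · intro n M w δ hδ hT x hx
    -- Enlarging the support to exactly `s` indices leaves only `d.choose s` subspaces to cover.
    obtain ⟨S, hxS, -, hSc⟩ := Finset.exists_subsuperset_card_eq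
      (Finset.subset_univ (Finset.univ.filter fun j => x j ≠ 0)) hx (by simpa using hsd)
    have hmem : S ∈ Finset.powersetCard s (Finset.univ : Finset (Fin d)) :=
      Finset.mem_powersetCard.2 ⟨Finset.subset_univ _, hSc⟩
    rw [← gramDeviationBilin_self]
    refine hN S _ δ (fun p hp q hq => ?_) x fun j hj => ?_
    · have hadd := hT (p + q) (Finset.mem_biUnion.2 ⟨S, hmem, Finset.mem_union_left _
        (Finset.mem_image₂_of_mem hp hq)⟩)
      have hsub := hT (p - q) (Finset.mem_biUnion.2 ⟨S, hmem, Finset.mem_union_right _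
        (Finset.mem_image₂_of_mem hp hq)⟩)
      -- Since `‖p + q‖² + ‖p - q‖² ≤ 4`, the division by 4 in the polarization identity gives back
      -- exactly `δ`.
      have hpar := parallelogram_law_with_norm ℝ p q
      have hp1 : ‖p‖ * ‖p‖ ≤ 1 := mul_le_one₀ (hN1 S p hp) (norm_nonneg _) (hN1 S p hp)
      have hq1 : ‖q‖ * ‖q‖ ≤ 1 := mul_le_one₀ (hN1 S q hq) (norm_nonneg _) (hN1 S q hq)
      rw [gramDeviationBilin_eq_polarization, abs_div, abs_of_pos (four_pos (α := ℝ)),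
        div_le_iff₀ four_pos]
      calc _ ≤ δ * ‖p + q‖ ^ 2 + δ * ‖p - q‖ ^ 2 := (abs_sub _ _).trans (add_le_add hadd hsub)
        _ = δ * (‖p + q‖ * ‖p + q‖ + ‖p - q‖ * ‖p - q‖) := by ring
        _ ≤ δ * 4 := by
          gcongr
          linarith
    · by_contra hne
      exact hj (hxS (by simpa using hne))

/-- From `s ^ s / s! ≤ exp s` follows `d.choose s ≤ (e * d / s) ^ s`. Moreover `50 ≤ exp 4`, and
since the logarithm is at least 1 the extra `4 * s` is absorbed: `5 = 1 + 4`. -/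
lemma choose_mul_pow_le_exp {d s : ℕ} (hs : 0 < s) (hsd : s ≤ d) :
    ((d.choose s * 50 ^ s : ℕ) : ℝ) ≤
      Real.exp (5 * (s * Real.log (Real.exp 1 * d / s))) := by
  have hs' : (0 : ℝ) < s := Nat.cast_pos.2 hs
  have hd' : (0 : ℝ) < d := Nat.cast_pos.2 (hs.trans_le hsd)
  have hlog : 1 ≤ Real.log (Real.exp 1 * d / s) := by
    rw [Real.le_log_iff_exp_le (by positivity), le_div_iff₀ hs']
    gcongr
  have hchoose : (d.choose s : ℝ) ≤ Real.exp (s * Real.log (Real.exp 1 * d / s)) := by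
    have hfac := Real.pow_div_factorial_le_exp (s : ℝ) hs'.le s
    rw [div_le_iff₀ (by positivity)] at hfac
    refine (Nat.choose_le_pow_div s d).trans ?_
    rw [Real.exp_nat_mul, Real.exp_log (by positivity), div_pow, mul_pow, ← Real.exp_nat_mul,
      mul_one, div_le_div_iff₀ (by positivity) (by positivity)]
    calc (d : ℝ) ^ s * s ^ s ≤ d ^ s * (Real.exp s * s.factorial) := by gcongr
      _ = _ := by ring
  have h50 : (50 : ℝ) ≤ Real.exp 4 := by
    have h1 : (2.7 : ℝ) ≤ Real.exp 1 := by linarith [Real.exp_one_gt_d9]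
    calc (50 : ℝ) ≤ 2.7 ^ 4 := by norm_num
      _ ≤ Real.exp 1 ^ 4 := by gcongr
      _ = Real.exp 4 := by rw [← Real.exp_nat_mul]; norm_num
  push_cast
  calc (d.choose s : ℝ) * 50 ^ s
      ≤ Real.exp (s * Real.log (Real.exp 1 * d / s)) * Real.exp 4 ^ s := by gcongr
    _ = Real.exp (s * Real.log (Real.exp 1 * d / s) + s * 4) := by
      rw [← Real.exp_nat_mul, ← Real.exp_add]
    _ ≤ _ := by
      gcongr
      nlinarith

/-! ### Concentration for sub-Gaussian designs -/

section Design

variable {Ω : Type*} [MeasurableSpace Ω] {μ : Measure Ω}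

/-- Independence of a family indexed by a product gives independence of its slices. -/
lemma iIndepFun_curry {ι κ X : Type*} [MeasurableSpace X] [IsProbabilityMeasure μ]
    {f : ι → κ → Ω → X} (hf : ∀ i j, Measurable (f i j))
    (h : iIndepFun (fun (p : ι × κ) => f p.1 p.2) μ) :
    iIndepFun (fun i ω j => f i j ω) μ := by
  have hp : ∀ i j, IsProbabilityMeasure (μ.map (f i j)) :=
    fun i j => Measure.isProbabilityMeasure_map (hf i j).aemeasurable
  have hslice : ∀ i, iIndepFun (f i) μ := fun i =>
    h.precomp (g := fun j => (i, j)) fun _ _ hj => (Prod.ext_iff.1 hj).2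
  have : ∀ i, IsProbabilityMeasure (μ.map fun ω j => f i j ω) :=
    fun i => Measure.isProbabilityMeasure_map (Measurable.aemeasurable (by fun_prop))
  rw [iIndepFun_iff_map_fun_eq_infinitePi_map (by fun_prop)]
  -- The joint law is a product measure, and currying turns it into the product of the laws of the
  -- slices.
  have hmap := (iIndepFun_iff_map_fun_eq_infinitePi_map (by fun_prop)).1 h
  have hcomp : (fun ω i j => f i j ω) =
      MeasurableEquiv.curry ι κ X ∘ fun ω (p : ι × κ) => f p.1 p.2 ω := rfl
  rw [hcomp, ← Measure.map_map (by fun_prop) (by fun_prop), hmap,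
    Measure.infinitePi_map_curry fun i j => μ.map (f i j)]
  congr 1
  funext i
  exact ((iIndepFun_iff_map_fun_eq_infinitePi_map (by fun_prop)).1 (hslice i)).symm

variable [IsProbabilityMeasure μ] {n d : ℕ} {A : Ω → Matrix (Fin n) (Fin d) ℝ} {σ : ℝ}

lemma IsSubGaussianDesign.hasSubgaussianMGF_row (hA : IsSubGaussianDesign A σ μ) (hσ : 0 < σ)
    (x : EuclideanSpace ℝ (Fin d)) (i : Fin n) :
    HasSubgaussianMGF (fun ω => ∑ j, A ω i j * x j) (56 * (σ ^ 2 * ‖x‖ ^ 2).toNNReal) μ := by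
  have hrow : iIndepFun (fun j ω => x j * A ω i j) μ :=
    (hA.indep.precomp (g := fun j => (i, j)) fun _ _ hj => (Prod.ext_iff.1 hj).2).comp
      (fun j y => x j * y) fun j => by fun_prop
  have h := HasSubgaussianMGF.sum_of_iIndepFun hrow (s := Finset.univ)
    (c := fun j => NNReal.mk (x j ^ 2) (sq_nonneg _) * (56 * (σ ^ 2).toNNReal)) fun j _ =>
    ((hA.subGaussian i j).hasSubgaussianMGF hσ).const_mul (x j)
  have hc : ∑ j, NNReal.mk (x j ^ 2) (sq_nonneg _) * (56 * (σ ^ 2).toNNReal)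
      = 56 * (σ ^ 2 * ‖x‖ ^ 2).toNNReal := by
    rw [← NNReal.coe_inj]
    push_cast
    rw [Real.coe_toNNReal _ (by positivity), Real.coe_toNNReal _ (by positivity),
      EuclideanSpace.real_norm_sq_eq, ← Finset.sum_mul]
    ring
  rw [hc] at h
  simpa only [mul_comm] using h

/-- Variances of independent centered entries add, so rows are isotropic; this identifies `n * v` as
the centre of the deviation. -/
lemma IsSubGaussianDesign.integral_row_sq (hA : IsSubGaussianDesign A σ μ) (hσ : 0 < σ) {v : ℝ}
    (hv : ∀ i j, variance (fun ω => A ω i j) μ = v) (x : EuclideanSpace ℝ (Fin d)) (i : Fin n) :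
    ∫ ω, (∑ j, A ω i j * x j) ^ 2 ∂μ = v * ‖x‖ ^ 2 := by
  have hrow : iIndepFun (fun j ω => A ω i j * x j) μ :=
    (hA.indep.precomp (g := fun j => (i, j)) fun _ _ hj => (Prod.ext_iff.1 hj).2).comp
      (fun j y => y * x j) fun j => by fun_prop
  have hL : ∀ j, MemLp (fun ω => A ω i j) 2 μ := fun j =>
    ((hA.subGaussian i j).hasSubgaussianMGF hσ).memLp 2
  have h0 : ∫ ω, ∑ j, A ω i j * x j ∂μ = 0 := by
    rw [integral_finsetSum _ fun j _ => (hA.subGaussian i j).1.mul_const _]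
    refine Finset.sum_eq_zero fun j _ => ?_
    rw [integral_mul_const, (hA.subGaussian i j).2.1, zero_mul]
  have hm : AEMeasurable (fun ω => ∑ j, A ω i j * x j) μ :=
    (hA.hasSubgaussianMGF_row hσ x i).aemeasurable
  rw [← variance_of_integral_eq_zero hm h0]
  have hsum : (fun ω => ∑ j, A ω i j * x j) = ∑ j, fun ω => A ω i j * x j := by
    ext ω
    simp
  rw [hsum, IndepFun.variance_sum (fun j _ => (hL j).mul_const _)
    fun j _ k _ hjk => hrow.indepFun hjk, EuclideanSpace.real_norm_sq_eq, Finset.mul_sum]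
  refine Finset.sum_congr rfl fun j _ => ?_
  rw [← hv i j, variance_mul_const, mul_comm]

/-- Concentration of `‖A x‖ ^ 2` for a fixed vector `x`. -/
lemma IsSubGaussianDesign.measureReal_gramDeviation_gt_le (hA : IsSubGaussianDesign A σ μ)
    (hσ : 0 < σ) {v B : ℝ} (hB : 0 < B) (hv : ∀ i j, variance (fun ω => A ω i j) μ = v)
    (hvB : σ ^ 2 ≤ B * v) (x : EuclideanSpace ℝ (Fin d)) :
    μ.real {ω | n * v / 8 * ‖x‖ ^ 2 < |gramDeviation (A ω) (n * v) x|} ≤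
      2 * Real.exp (-(n : ℝ) / (786432 * 3136 * B ^ 2)) := by
  have hm := hA.measurable
  -- At `x = 0` the sub-Gaussian parameter degenerates to 0, but the event is empty.
  rcases eq_or_ne x 0 with rfl | hx
  · simp [gramDeviation]
    positivity
  have hx' : 0 < ‖x‖ := norm_pos_iff.2 hx
  have hrows : iIndepFun (fun i ω => ∑ j, A ω i j * x j) μ :=
    (iIndepFun_curry (f := fun i j ω => A ω i j) hm hA.indep).comp
      (fun _ r => ∑ j, r j * x j) fun _ => by fun_prop
  have h := measureReal_abs_sum_sq_sub_gt_le hrows (fun i => by fun_prop)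
    (by have : 0 < (σ ^ 2 * ‖x‖ ^ 2).toNNReal := Real.toNNReal_pos.2 (by positivity)
        positivity)
    (hA.hasSubgaussianMGF_row hσ x) (hA.integral_row_sq hσ hv x)
  have hset : {ω | n * v / 8 * ‖x‖ ^ 2 < |gramDeviation (A ω) (n * v) x|} =
      {ω | n * (v * ‖x‖ ^ 2 / 8) < |∑ i, (∑ j, A ω i j * x j) ^ 2 - n * (v * ‖x‖ ^ 2)|} := by
    have e : n * v / 8 * ‖x‖ ^ 2 = n * (v * ‖x‖ ^ 2 / 8) := by ring
    simp only [gramDeviation, e, mul_assoc]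
  rw [hset]
  refine h.trans ?_
  push_cast
  rw [Real.coe_toNNReal _ (by positivity)]
  gcongr
  rw [neg_mul, neg_div]
  gcongr
  -- The norm of `x` cancels and `σ ^ 2 ≤ B * v` leaves a rate depending on `B` alone; `3136 = 56 ^
  -- 2`.
  have hratio : 1 / (786432 * 3136 * B ^ 2) ≤
      (v * ‖x‖ ^ 2) ^ 2 / (786432 * (56 * (σ ^ 2 * ‖x‖ ^ 2)) ^ 2) := by
    rw [div_le_div_iff₀ (by positivity) (by positivity)]
    have h2 : (σ ^ 2) ^ 2 ≤ (B * v) ^ 2 := by gcongr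
    calc 1 * (786432 * (56 * (σ ^ 2 * ‖x‖ ^ 2)) ^ 2)
        = 786432 * 3136 * (‖x‖ ^ 2) ^ 2 * (σ ^ 2) ^ 2 := by ring
      _ ≤ 786432 * 3136 * (‖x‖ ^ 2) ^ 2 * (B * v) ^ 2 := by gcongr
      _ = _ := by ring
  calc (n : ℝ) / (786432 * 3136 * B ^ 2) = 1 / (786432 * 3136 * B ^ 2) * n := by ring
    _ ≤ _ := by gcongr

/-- With high probability the deviation is small uniformly over `s`-sparse vectors. -/
lemma IsSubGaussianDesign.le_measure_gramDeviation_le (hA : IsSubGaussianDesign A σ μ)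
    (hσ : 0 < σ) {v B : ℝ} (hB : 0 < B) (hv : ∀ i j, variance (fun ω => A ω i j) μ = v)
    (hvB : σ ^ 2 ≤ B * v) {s : ℕ} (hs : 0 < s) (hsd : s ≤ d)
    (hn : 8 * (786432 * 3136 * B ^ 2) * s * Real.log (Real.exp 1 * d / s) ≤ n) :
    ENNReal.ofReal (1 - 2 * Real.exp (-(n : ℝ) / (8 * (786432 * 3136 * B ^ 2)))) ≤
      μ {ω | ∀ x : EuclideanSpace ℝ (Fin d), hammingNorm x.ofLp ≤ s →
        |gramDeviation (A ω) (n * v) x| ≤ n * v / 2 * ‖x‖ ^ 2} := by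
  have hv0 : 0 ≤ v := (pos_of_mul_pos_right ((sq_pos_of_pos hσ).trans_le hvB) hB.le).le
  obtain ⟨T, hTc, hT⟩ := exists_test_vectors hs hsd
  set C : ℝ := 786432 * 3136 * B ^ 2 with hC
  have hC0 : 0 < C := by positivity
  set bad : Set Ω := ⋃ p ∈ T, {ω | n * v / 8 * ‖p‖ ^ 2 < |gramDeviation (A ω) (n * v) p|}
    with hbad
  have hprob : μ.real bad ≤ 2 * Real.exp (-(n : ℝ) / (8 * C)) := by
    calc μ.real bad ≤ ∑ p ∈ T, μ.real {ω | n * v / 8 * ‖p‖ ^ 2 <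
          |gramDeviation (A ω) (n * v) p|} := measureReal_biUnion_finset_le _ _
      _ ≤ ∑ _p ∈ T, 2 * Real.exp (-(n : ℝ) / C) := by
          gcongr with p
          exact hA.measureReal_gramDeviation_gt_le hσ hB hv hvB p
      _ = T.card * (2 * Real.exp (-(n : ℝ) / C)) := by
          rw [Finset.sum_const, nsmul_eq_mul]
      _ ≤ Real.exp (5 * (s * Real.log (Real.exp 1 * d / s)))
          * (2 * Real.exp (-(n : ℝ) / C)) := by
          gcongr
          exact (Nat.cast_le.2 hTc).trans (choose_mul_pow_le_exp hs hsd)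
      _ = 2 * Real.exp (5 * (s * Real.log (Real.exp 1 * d / s)) + -(n : ℝ) / C) := by
          rw [Real.exp_add]
          ring
      _ ≤ _ := by
          gcongr
          -- The union bound spends at most `5/8` of the exponent `n / C`, and more than the
          -- required `1/8` remains.
          have h1 : s * Real.log (Real.exp 1 * d / s) ≤ n / C / 8 := by
            rw [div_div, le_div_iff₀ (by positivity)]
            linarith
          have h2 : (0 : ℝ) ≤ n / C := by positivity
          have h3 : -(n : ℝ) / (8 * C) = -(n / C / 8) := by
            field_simp
          rw [h3, neg_div]
          linarith
  have hsub : badᶜ ⊆ {ω | ∀ x : EuclideanSpace ℝ (Fin d), hammingNorm x.ofLp ≤ s →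
      |gramDeviation (A ω) (n * v) x| ≤ n * v / 2 * ‖x‖ ^ 2} := by
    intro ω hω x hx
    have h := hT n (A ω) (n * v) (n * v / 8) (by positivity) (fun p hp => ?_) x hx
    · calc _ ≤ _ := h
        _ = _ := by ring
    · by_contra! hlt
      exact hω (Set.mem_biUnion hp hlt)
  calc _ ≤ ENNReal.ofReal (μ.real badᶜ) := by
        refine ENNReal.ofReal_le_ofReal ?_
        -- Subadditivity is enough here, so measurability of `bad` plays no role.
        have h1 : 1 ≤ μ.real bad + μ.real badᶜ := by
          have h := measureReal_union_le (μ := μ) bad badᶜ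
          rwa [Set.union_compl_self, probReal_univ] at h
        linarith
    _ = μ badᶜ := ofReal_measureReal
    _ ≤ _ := measure_mono hsub

end Design

/-! ### From restricted isometry to the condition number -/

/-- The ridge term adds the same `γ ≥ 0` to both curvature bounds, which can only improve the ratio
`(3v/2) / (v/2) = 3`. -/
lemma exists_isRestrictedConditionNumber_leastSquares {n d p q s : ℕ} (hn : 0 < n) (hd : 0 < d)
    (hp : 0 < p) (hq : 0 < q) (hps : p ≤ s) (hqs : q ≤ s) {M : Matrix (Fin n) (Fin d) ℝ}
    (y : Fin n → ℝ) {v γ : ℝ} (hv : 0 < v) (hγ : 0 ≤ γ)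
    (h : ∀ x : EuclideanSpace ℝ (Fin d), hammingNorm x.ofLp ≤ s →
      |gramDeviation M (n * v) x| ≤ n * v / 2 * ‖x‖ ^ 2) :
    ∃ c, IsRestrictedConditionNumber (leastSquares M y γ) p q c ∧ c ≤ 3 := by
  have hn' : (0 : ℝ) < n := Nat.cast_pos.2 hn
  have hneg : ∀ x x' : EuclideanSpace ℝ (Fin d),
      hammingNorm (x' - x).ofLp = hammingNorm (x - x').ofLp := fun x x' => by
    simp only [hammingNorm, WithLp.ofLp_sub, Pi.sub_apply, sub_ne_zero]
    exact congrArg Finset.card (Finset.filter_congr fun j _ => ne_comm)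
  refine exists_isRestrictedConditionNumber_le hd hp hq (a := v / 2 + γ) (b := 3 / 2 * v + γ)
    ⟨differentiable_leastSquares M y γ, by positivity, fun x x' hx => ?_⟩
    ⟨differentiable_leastSquares M y γ, fun x x' hx => ?_⟩ (by linarith) (by norm_num)
  · have h1 := (abs_le.1 (h (x' - x) ((hneg x x').trans_le (hx.trans hqs)))).1
    rw [gramDeviation] at h1
    rw [leastSquares_taylor_remainder]
    set Q := ∑ i, (∑ j, M i j * (x' - x) j) ^ 2
    calc (v / 2 + γ) / 2 * ‖x' - x‖ ^ 2
        = 1 / (2 * (n : ℝ)) * (n * v / 2 * ‖x' - x‖ ^ 2) + γ / 2 * ‖x' - x‖ ^ 2 := by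
          field_simp
      _ ≤ _ := by gcongr; linarith
  · have h1 := (abs_le.1 (h (x' - x) ((hneg x x').trans_le (hx.trans hps)))).2
    rw [gramDeviation] at h1
    rw [leastSquares_taylor_remainder]
    set Q := ∑ i, (∑ j, M i j * (x' - x) j) ^ 2
    calc 1 / (2 * (n : ℝ)) * Q + γ / 2 * ‖x' - x‖ ^ 2
        ≤ 1 / (2 * (n : ℝ)) * (3 * (n * v / 2 * ‖x' - x‖ ^ 2)) + γ / 2 * ‖x' - x‖ ^ 2 := by
          gcongr
          linarith
      _ = (3 / 2 * v + γ) / 2 * ‖x' - x‖ ^ 2 := by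
          field_simp

end SparseRegression

theorem proposition11 (B : ℝ) (hB : 1 ≤ B) :
    ∃ C₁ : ℝ, 0 < C₁ ∧
      ∀ (Ω : Type*) [MeasurableSpace Ω] (μ : Measure Ω) [IsProbabilityMeasure μ]
        (n d k K : ℕ) (σ γ : ℝ) (A : Ω → Matrix (Fin n) (Fin d) ℝ)
        (xstar : Fin d → ℝ) (ε : Ω → Fin n → ℝ),
        0 < k + K → 3 * k + K ≤ d → 0 < σ → 0 ≤ γ →
        SparseRegression.IsSubGaussianDesign A σ μ →
        (∀ i j, σ ^ 2 ≤ B * variance (fun ω => A ω i j) μ) →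
        8 * C₁ * (3 * k + K : ℝ) * Real.log (Real.exp 1 * d / (3 * k + K : ℝ)) ≤ n →
        ENNReal.ofReal (1 - 2 * Real.exp (-(n : ℝ) / (8 * C₁))) ≤
          μ {ω | ∃ c : ℝ,
            SparseRegression.IsRestrictedConditionNumber
              (SparseRegression.leastSquares (A ω) ((A ω).mulVec xstar + ε ω) γ)
              (2 * k + K) (k + K) c ∧ c ≤ 3} := by
  have hB0 : 0 < B := one_pos.trans_le hB
  refine ⟨786432 * 3136 * B ^ 2, by positivity, ?_⟩
  intro Ω _ μ _ n d k K σ γ A xstar ε hkK hd hσ hγ hA hvar hn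
  have hcast : (3 * k + K : ℝ) = ((3 * k + K : ℕ) : ℝ) := by push_cast; rfl
  rw [hcast] at hn
  set s := 3 * k + K with hs
  have hs0 : 0 < s := by omega
  have hd0 : 0 < d := hs0.trans_le hd
  -- The logarithm is positive as `s ≤ d`, so the sample-size hypothesis excludes `n = 0`; an entry
  -- is then available to define `v`.
  have hn0 : 0 < n := by
    have hs' : (0 : ℝ) < s := Nat.cast_pos.2 hs0
    have hlog : 0 < Real.log (Real.exp 1 * d / s) := by
      refine Real.log_pos ((one_lt_div hs').2 ?_)
      have h1 : (s : ℝ) ≤ d := Nat.cast_le.2 hd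
      have h2 : (1 : ℝ) < Real.exp 1 := Real.one_lt_exp_iff.2 one_pos
      nlinarith
    exact Nat.cast_pos.1 (lt_of_lt_of_le (by positivity) hn)
  set v := variance (fun ω => A ω ⟨0, hn0⟩ ⟨0, hd0⟩) μ with hvdef
  have hv : ∀ i j, variance (fun ω => A ω i j) μ = v := fun i j =>
    (hA.identDistrib (i, j) (⟨0, hn0⟩, ⟨0, hd0⟩)).variance_eq
  have hvB : σ ^ 2 ≤ B * v := hvar _ _
  have hv0 : 0 < v := pos_of_mul_pos_right ((sq_pos_of_pos hσ).trans_le hvB) hB0.le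
  refine (hA.le_measure_gramDeviation_le hσ hB0 hv hvB hs0 hd hn).trans
    (measure_mono fun ω hω => ?_)
  exact SparseRegression.exists_isRestrictedConditionNumber_leastSquares hn0 hd0 (by omega) hkK
    (s := s) (by omega) (by omega) _ hv0 hγ hω
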